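/- **Definitions.** An implicative meet-semilattice is a (non-empty) meet-semilattice $(A,\wedge)$ with a binary operation $\to$ such that $a\wedge b\le c\iff a\le b\to c$; it has a largest element $1$. A $(\wedge,\to)$-homomorphism is a map preserving $\wedge$ and $\to$. For a poset $X$, $\mathcal U(X)$ denotes the Heyting algebra of up-sets of $X$ ordered by inclusion, with $U\to V=\{x : \forall y\ge x\,(y\in U\Rightarrow y\in V)\}$. Let $n\ge 0$. - $F_{HA}(n)$, the free Heyting algebra on $p_1,\dots,p_n$, is the Lindenbaum algebra of intuitionistic propositional logic (IPC) in the variables $p_1,\dots,p_n$. $F_{\wedge,\to}(n)$, the free implicative meet-semilattice on $p_1,\dots,p_n$, consists of the formulas built from $p_1,\dots,p_n$ (and $\top$) with $\wedge$ and $\to$, modulo provable equivalence in IPC. - A model (in $n$ variables) is a poset $M$ with an order-preserving map $c:M\to 2^n$. A p-morphism $f:M\to N$ of models is an order-preserving map with $c_N\circ f=c_M$ such that $f(x)\le y$ implies $f(x')=y$ for some $x'\ge x$. - A point $x\in M$ is separated if there is $i$ with $c(x)_i=0$ and $c(y)_i=1$ for all $y>x$. $M^s$ is the set of separated points of $M$,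 with the restricted order and colouring. - The universal model $U(n)$ is the set of those prime filters $x$ of $F_{HA}(n)$ (proper, ordered by inclusion) which are contained in only finitely many prime filters, with $c(x)_i=1$ iff $p_i\in x$. - $U(n)_{\wedge,\to}\subseteq U(n)$ is the image of the p-morphism $U(n)^s\to U(n)$, with the order and colouring of $U(n)$. **Theorem (Diego).** For every $n\ge 0$, there is exactly one p-morphism $U(n)^s\to U(n)$ (so that $U(n)_{\wedge,\to}$ is well defined), and $F_{\wedge,\to}(n)$ embeds as a $(\wedge,\to)$-subalgebra into $\mathcal U(U(n)_{\wedge,\to})$, that is, there is an injective $(\wedge,\to)$-homomorphism $F_{\wedge,\to}(n)\to\mathcal U(U(n)_{\wedge,\to})$. Moreover, $F_{\wedge,\to}(n)$ is finite, and the variety of implicative meet-semilattices is locally finite: every finite subset of an implicative meet-semilattice generates a finite $(\wedge,\to)$-subalgebra. -/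

import Mathlib

universe u v

namespace IPC

/-! ### Implicative meet-semilattices -/

/-- An implicative meet-semilattice: a meet-semilattice with an operation `⇨` such that
`a ⊓ b ≤ c ↔ a ≤ b ⇨ c`. It always has a largest element, namely `a ⇨ a` for any `a`; recording
it in the structure only excludes the empty algebra. -/
class ImplicativeMeetSemilattice (A : Type u) extends SemilatticeInf A, OrderTop A, HImp A where
  le_himp_iff_inf_le : ∀ a b c : A, a ≤ b ⇨ c ↔ a ⊓ b ≤ c

/-- A `(∧,→)`-homomorphism (it automatically preserves the largest element `a ⇨ a`). -/
structure MeetImpHom (A : Type u) (B : Type v) [ImplicativeMeetSemilattice A]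
    [ImplicativeMeetSemilattice B] where
  toFun : A → B
  map_inf : ∀ a b : A, toFun (a ⊓ b) = toFun a ⊓ toFun b
  map_himp : ∀ a b : A, toFun (a ⇨ b) = toFun a ⇨ toFun b

/-- A `(∧,→)`-subalgebra: a subset containing `1` and closed under `∧` and `→`. -/
structure IsSubalgebra {A : Type u} [ImplicativeMeetSemilattice A] (T : Set A) : Prop where
  top_mem : ⊤ ∈ T
  inf_mem : ∀ a ∈ T, ∀ b ∈ T, a ⊓ b ∈ T
  himp_mem : ∀ a ∈ T, ∀ b ∈ T, a ⇨ b ∈ T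

/-- The `(∧,→)`-subalgebra generated by `S`: the intersection of all subalgebras containing `S`. -/
def generated {A : Type u} [ImplicativeMeetSemilattice A] (S : Set A) : Set A :=
  ⋂₀ {T : Set A | IsSubalgebra T ∧ S ⊆ T}

/-! ### Up-sets -/

/-- The up-sets of a poset, ordered by inclusion. -/
def UpSets (X : Type u) [PartialOrder X] : Type u := {U : Set X // IsUpperSet U}

/-- The implicative structure of the Heyting algebra of up-sets: meet is intersection, and
`x ∈ U ⇨ V` iff every `y ≥ x` that lies in `U` lies in `V`. -/
instance (X : Type u) [PartialOrder X] : ImplicativeMeetSemilattice (UpSets X) where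
  le U V := U.1 ⊆ V.1
  le_refl U := Set.Subset.refl U.1
  le_trans _ _ _ h h' := Set.Subset.trans h h'
  le_antisymm _ _ h h' := Subtype.ext (Set.Subset.antisymm h h')
  inf U V := ⟨U.1 ∩ V.1, U.2.inter V.2⟩
  inf_le_left _ _ := Set.inter_subset_left
  inf_le_right _ _ := Set.inter_subset_right
  le_inf _ _ _ h h' := Set.subset_inter h h'
  top := ⟨Set.univ, isUpperSet_univ⟩
  le_top U := Set.subset_univ U.1
  himp U V := ⟨{x | ∀ y, x ≤ y → y ∈ U.1 → y ∈ V.1},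
    fun _ _ hab ha y hby => ha y (hab.trans hby)⟩
  le_himp_iff_inf_le U _ _ :=
    ⟨fun h x hx => h hx.1 x le_rfl hx.2, fun h _ hx y hxy hy => h ⟨U.2 hxy hx, hy⟩⟩

/-! ### Intuitionistic propositional logic -/

/-- Formulas of intuitionistic propositional logic in the variables `p_0, …, p_{n-1}`. -/
inductive Formula (n : ℕ) : Type
  | var (i : Fin n) : Formula n
  | bot : Formula n
  | top : Formula n
  | and (φ ψ : Formula n) : Formula n
  | or (φ ψ : Formula n) : Formula n
  | imp (φ ψ : Formula n) : Formula n

/-- Provability from a set of assumptions in intuitionistic propositional logic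
(natural deduction). -/
inductive Provable {n : ℕ} : Set (Formula n) → Formula n → Prop
  | ax {Γ : Set (Formula n)} {φ : Formula n} : φ ∈ Γ → Provable Γ φ
  | topI {Γ : Set (Formula n)} : Provable Γ Formula.top
  | botE {Γ : Set (Formula n)} {φ : Formula n} : Provable Γ Formula.bot → Provable Γ φ
  | andI {Γ : Set (Formula n)} {φ ψ : Formula n} :
      Provable Γ φ → Provable Γ ψ → Provable Γ (φ.and ψ)
  | andE₁ {Γ : Set (Formula n)} {φ ψ : Formula n} : Provable Γ (φ.and ψ) → Provable Γ φ
  | andE₂ {Γ : Set (Formula n)} {φ ψ : Formula n} : Provable Γ (φ.and ψ) → Provable Γ ψ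
  | orI₁ {Γ : Set (Formula n)} {φ ψ : Formula n} : Provable Γ φ → Provable Γ (φ.or ψ)
  | orI₂ {Γ : Set (Formula n)} {φ ψ : Formula n} : Provable Γ ψ → Provable Γ (φ.or ψ)
  | orE {Γ : Set (Formula n)} {φ ψ χ : Formula n} : Provable Γ (φ.or ψ) →
      Provable (insert φ Γ) χ → Provable (insert ψ Γ) χ → Provable Γ χ
  | impI {Γ : Set (Formula n)} {φ ψ : Formula n} :
      Provable (insert φ Γ) ψ → Provable Γ (φ.imp ψ)
  | impE {Γ : Set (Formula n)} {φ ψ : Formula n} :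
      Provable Γ (φ.imp ψ) → Provable Γ φ → Provable Γ ψ

theorem Provable.weaken {n : ℕ} {Γ Δ : Set (Formula n)} {φ : Formula n} (h : Provable Γ φ)
    (hs : Γ ⊆ Δ) : Provable Δ φ := by
  induction h generalizing Δ with
  | ax h => exact .ax (hs h)
  | topI => exact .topI
  | botE _ ih => exact .botE (ih hs)
  | andI _ _ ih₁ ih₂ => exact .andI (ih₁ hs) (ih₂ hs)
  | andE₁ _ ih => exact .andE₁ (ih hs)
  | andE₂ _ ih => exact .andE₂ (ih hs)
  | orI₁ _ ih => exact .orI₁ (ih hs)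
  | orI₂ _ ih => exact .orI₂ (ih hs)
  | orE _ _ _ ih ih₁ ih₂ =>
    exact .orE (ih hs) (ih₁ (Set.insert_subset_insert hs)) (ih₂ (Set.insert_subset_insert hs))
  | impI _ ih => exact .impI (ih (Set.insert_subset_insert hs))
  | impE _ _ ih₁ ih₂ => exact .impE (ih₁ hs) (ih₂ hs)

theorem Provable.cut {n : ℕ} {Γ : Set (Formula n)} {φ ψ : Formula n} (h : Provable Γ φ)
    (h' : Provable {φ} ψ) : Provable Γ ψ :=
  .impE (.impI (h'.weaken (Set.singleton_subset_iff.2 (Set.mem_insert φ Γ)))) h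

/-- The preorder `φ ≼ ψ`: `ψ` is provable from `φ`. -/
def Entails {n : ℕ} (φ ψ : Formula n) : Prop := Provable {φ} ψ

theorem Entails.refl {n : ℕ} (φ : Formula n) : Entails φ φ := .ax rfl

theorem Entails.trans {n : ℕ} {φ ψ χ : Formula n} (h : Entails φ ψ) (h' : Entails ψ χ) :
    Entails φ χ := Provable.cut h h'

theorem Entails.andI {n : ℕ} {φ ψ χ : Formula n} (h : Entails φ ψ) (h' : Entails φ χ) :
    Entails φ (ψ.and χ) := Provable.andI h h'

theorem Entails.andE₁ {n : ℕ} (φ ψ : Formula n) : Entails (φ.and ψ) φ := Provable.andE₁ (Provable.ax rfl)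

theorem Entails.andE₂ {n : ℕ} (φ ψ : Formula n) : Entails (φ.and ψ) ψ := Provable.andE₂ (Provable.ax rfl)

theorem Entails.orI₁ {n : ℕ} (φ ψ : Formula n) : Entails φ (φ.or ψ) := Provable.orI₁ (Provable.ax rfl)

theorem Entails.orI₂ {n : ℕ} (φ ψ : Formula n) : Entails ψ (φ.or ψ) := Provable.orI₂ (Provable.ax rfl)

theorem Entails.orE {n : ℕ} {φ ψ χ : Formula n} (h : Entails φ χ) (h' : Entails ψ χ) :
    Entails (φ.or ψ) χ :=
  Provable.orE (Provable.ax rfl) (Provable.weaken h (by simp)) (Provable.weaken h' (by simp))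

theorem Entails.imp_iff {n : ℕ} {φ ψ χ : Formula n} :
    Entails φ (ψ.imp χ) ↔ Entails (φ.and ψ) χ := by
  constructor
  · intro h
    exact .impE (Provable.cut (.andE₁ (.ax rfl)) h) (.andE₂ (.ax rfl))
  · intro h
    exact .impI (Provable.cut (.andI (.ax (by simp)) (.ax (by simp))) h)

theorem Entails.and_mono {n : ℕ} {φ φ' ψ ψ' : Formula n} (h : Entails φ φ') (h' : Entails ψ ψ') :
    Entails (φ.and ψ) (φ'.and ψ') :=
  ((Entails.andE₁ φ ψ).trans h).andI ((Entails.andE₂ φ ψ).trans h')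

theorem Entails.or_mono {n : ℕ} {φ φ' ψ ψ' : Formula n} (h : Entails φ φ') (h' : Entails ψ ψ') :
    Entails (φ.or ψ) (φ'.or ψ') :=
  (h.trans (Entails.orI₁ φ' ψ')).orE (h'.trans (Entails.orI₂ φ' ψ'))

theorem Entails.imp_mono {n : ℕ} {φ φ' ψ ψ' : Formula n} (h : Entails φ' φ) (h' : Entails ψ ψ') :
    Entails (φ.imp ψ) (φ'.imp ψ') :=
  Entails.imp_iff.2 (((Entails.refl (φ.imp ψ)).and_mono h).trans
    ((Entails.imp_iff.1 (Entails.refl (φ.imp ψ))).trans h'))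

/-- Provable equivalence of formulas. -/
def formulaSetoid (n : ℕ) : Setoid (Formula n) where
  r φ ψ := Entails φ ψ ∧ Entails ψ φ
  iseqv := ⟨fun φ => ⟨.refl φ, .refl φ⟩, fun h => ⟨h.2, h.1⟩,
    fun h h' => ⟨h.1.trans h'.1, h'.2.trans h.2⟩⟩

/-- The free Heyting algebra `F_HA(n)`, as the Lindenbaum algebra of intuitionistic
propositional logic in `n` variables. -/
def FreeHA (n : ℕ) : Type := Quotient (formulaSetoid n)

/-- The class of a formula in the Lindenbaum algebra. -/
def FreeHA.mk {n : ℕ} (φ : Formula n) : FreeHA n := Quotient.mk (formulaSetoid n) φ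

instance (n : ℕ) : HeytingAlgebra (FreeHA n) where
  le := Quotient.lift₂ (s₁ := formulaSetoid n) (s₂ := formulaSetoid n) Entails
    fun _ _ _ _ h h' => propext ⟨fun k => h.2.trans (k.trans h'.1), fun k => h.1.trans (k.trans h'.2)⟩
  le_refl := by rintro ⟨φ⟩; exact Entails.refl φ
  le_trans := by rintro ⟨φ⟩ ⟨ψ⟩ ⟨χ⟩; exact Entails.trans
  le_antisymm := by rintro ⟨φ⟩ ⟨ψ⟩ h h'; exact Quotient.sound ⟨h, h'⟩
  inf := Quotient.map₂ Formula.and fun _ _ h _ _ h' => ⟨h.1.and_mono h'.1, h.2.and_mono h'.2⟩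
  inf_le_left := by rintro ⟨φ⟩ ⟨ψ⟩; exact Entails.andE₁ φ ψ
  inf_le_right := by rintro ⟨φ⟩ ⟨ψ⟩; exact Entails.andE₂ φ ψ
  le_inf := by rintro ⟨φ⟩ ⟨ψ⟩ ⟨χ⟩; exact Entails.andI
  sup := Quotient.map₂ Formula.or fun _ _ h _ _ h' => ⟨h.1.or_mono h'.1, h.2.or_mono h'.2⟩
  le_sup_left := by rintro ⟨φ⟩ ⟨ψ⟩; exact Entails.orI₁ φ ψ
  le_sup_right := by rintro ⟨φ⟩ ⟨ψ⟩; exact Entails.orI₂ φ ψ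
  sup_le := by rintro ⟨φ⟩ ⟨ψ⟩ ⟨χ⟩; exact Entails.orE
  top := FreeHA.mk Formula.top
  le_top := by rintro ⟨φ⟩; exact Provable.topI
  bot := FreeHA.mk Formula.bot
  bot_le := by rintro ⟨φ⟩; exact Provable.botE (.ax rfl)
  himp := Quotient.map₂ Formula.imp fun _ _ h _ _ h' => ⟨h.2.imp_mono h'.1, h.1.imp_mono h'.2⟩
  le_himp_iff := by rintro ⟨φ⟩ ⟨ψ⟩ ⟨χ⟩; exact Entails.imp_iff
  compl := Quotient.map (fun φ => φ.imp Formula.bot)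
    fun _ _ h => ⟨h.2.imp_mono (.refl _), h.1.imp_mono (.refl _)⟩
  himp_bot := by rintro ⟨φ⟩; rfl

/-! ### The `(∧,→)`-fragment -/

/-- Formulas of the `(∧,→)`-fragment. The constant `⊤` is definable as `p → p` as soon as there is
a variable; it is listed so that `1` exists also when there are no variables. -/
inductive MIFormula (n : ℕ) : Type
  | var (i : Fin n) : MIFormula n
  | top : MIFormula n
  | and (φ ψ : MIFormula n) : MIFormula n
  | imp (φ ψ : MIFormula n) : MIFormula n

/-- A formula of the fragment, read as an intuitionistic formula. -/
def MIFormula.toFormula {n : ℕ} : MIFormula n → Formula n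
  | .var i => .var i
  | .top => .top
  | .and φ ψ => .and φ.toFormula ψ.toFormula
  | .imp φ ψ => .imp φ.toFormula ψ.toFormula

/-- The free implicative meet-semilattice `F_{∧,→}(n)`: formulas of the `(∧,→)`-fragment in `n`
variables, up to provable equivalence in intuitionistic propositional logic. -/
def FreeMI (n : ℕ) : Type := Quotient ((formulaSetoid n).comap MIFormula.toFormula)

/-- The class of a formula of the fragment. -/
def FreeMI.mk {n : ℕ} (φ : MIFormula n) : FreeMI n :=
  Quotient.mk ((formulaSetoid n).comap MIFormula.toFormula) φ

instance (n : ℕ) : ImplicativeMeetSemilattice (FreeMI n) where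
  le := Quotient.lift₂ (s₁ := (formulaSetoid n).comap MIFormula.toFormula)
    (s₂ := (formulaSetoid n).comap MIFormula.toFormula)
    (fun φ ψ => Entails φ.toFormula ψ.toFormula)
    fun _ _ _ _ h h' => propext ⟨fun k => h.2.trans (k.trans h'.1), fun k => h.1.trans (k.trans h'.2)⟩
  le_refl := by rintro ⟨φ⟩; exact Entails.refl φ.toFormula
  le_trans := by rintro ⟨φ⟩ ⟨ψ⟩ ⟨χ⟩; exact Entails.trans
  le_antisymm := by rintro ⟨φ⟩ ⟨ψ⟩ h h'; exact Quotient.sound ⟨h, h'⟩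
  inf := Quotient.map₂ MIFormula.and fun _ _ h _ _ h' => ⟨h.1.and_mono h'.1, h.2.and_mono h'.2⟩
  inf_le_left := by rintro ⟨φ⟩ ⟨ψ⟩; exact Entails.andE₁ φ.toFormula ψ.toFormula
  inf_le_right := by rintro ⟨φ⟩ ⟨ψ⟩; exact Entails.andE₂ φ.toFormula ψ.toFormula
  le_inf := by rintro ⟨φ⟩ ⟨ψ⟩ ⟨χ⟩; exact Entails.andI
  top := FreeMI.mk MIFormula.top
  le_top := by rintro ⟨φ⟩; exact Provable.topI
  himp := Quotient.map₂ MIFormula.imp fun _ _ h _ _ h' => ⟨h.2.imp_mono h'.1, h.1.imp_mono h'.2⟩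
  le_himp_iff_inf_le := by rintro ⟨φ⟩ ⟨ψ⟩ ⟨χ⟩; exact Entails.imp_iff

/-! The next facts show that `FreeMI n` is the free implicative meet-semilattice. -/

/-- The value of a formula in a Heyting algebra. -/
def Formula.eval {n : ℕ} {H : Type u} [HeytingAlgebra H] (a : Fin n → H) : Formula n → H
  | .var i => a i
  | .bot => ⊥
  | .top => ⊤
  | .and φ ψ => φ.eval a ⊓ ψ.eval a
  | .or φ ψ => φ.eval a ⊔ ψ.eval a
  | .imp φ ψ => φ.eval a ⇨ ψ.eval a

theorem Provable.sound {n : ℕ} {H : Type u} [HeytingAlgebra H] (a : Fin n → H)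
    {Γ : Set (Formula n)} {φ : Formula n} (h : Provable Γ φ) :
    ∀ x : H, (∀ γ ∈ Γ, x ≤ γ.eval a) → x ≤ φ.eval a := by
  have key : ∀ (Γ : Set (Formula n)) (φ : Formula n) (x : H), (∀ γ ∈ Γ, x ≤ γ.eval a) →
      ∀ γ ∈ insert φ Γ, x ⊓ φ.eval a ≤ γ.eval a := by
    intro Γ φ x hx γ hγ
    rcases hγ with rfl | hγ
    · exact inf_le_right
    · exact inf_le_left.trans (hx γ hγ)
  induction h with
  | ax h => exact fun x hx => hx _ h
  | topI => exact fun x _ => le_top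
  | botE _ ih => exact fun x hx => (ih x hx).trans bot_le
  | andI _ _ ih₁ ih₂ => exact fun x hx => le_inf (ih₁ x hx) (ih₂ x hx)
  | andE₁ _ ih => exact fun x hx => (ih x hx).trans inf_le_left
  | andE₂ _ ih => exact fun x hx => (ih x hx).trans inf_le_right
  | orI₁ _ ih => exact fun x hx => (ih x hx).trans le_sup_left
  | orI₂ _ ih => exact fun x hx => (ih x hx).trans le_sup_right
  | orE _ _ _ ih ih₁ ih₂ =>
    intro x hx
    refine (le_inf le_rfl (ih x hx)).trans ?_
    simp only [Formula.eval, inf_sup_left]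
    exact sup_le (ih₁ _ (key _ _ x hx)) (ih₂ _ (key _ _ x hx))
  | impI _ ih => exact fun x hx => le_himp_iff.2 (ih _ (key _ _ x hx))
  | impE _ _ ih₁ ih₂ =>
    exact fun x hx => (le_inf le_rfl (ih₂ x hx)).trans (le_himp_iff.1 (ih₁ x hx))

/-- The value of a formula of the fragment in an implicative meet-semilattice. -/
def MIFormula.eval {n : ℕ} {A : Type u} [ImplicativeMeetSemilattice A] (a : Fin n → A) :
    MIFormula n → A
  | .var i => a i
  | .top => ⊤
  | .and φ ψ => φ.eval a ⊓ ψ.eval a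
  | .imp φ ψ => φ.eval a ⇨ ψ.eval a

theorem MIFormula.eval_toFormula {n : ℕ} {A : Type u} [ImplicativeMeetSemilattice A]
    (a : Fin n → A) (φ : MIFormula n) :
    φ.toFormula.eval (fun i => LowerSet.Iic (a i)) = LowerSet.Iic (φ.eval a) := by
  induction φ with
  | var i => rfl
  | top => exact (LowerSet.Iic_top).symm
  | and φ ψ ih₁ ih₂ =>
    simp only [toFormula, Formula.eval, eval, ih₁, ih₂, LowerSet.Iic_inf]
  | imp φ ψ ih₁ ih₂ =>
    simp only [toFormula, Formula.eval, eval, ih₁, ih₂]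
    refine eq_of_forall_le_iff fun L => ?_
    rw [le_himp_iff]
    constructor
    · intro h x hx
      refine (ImplicativeMeetSemilattice.le_himp_iff_inf_le _ _ _).2 (h ⟨?_, ?_⟩)
      · exact L.lower inf_le_left hx
      · exact inf_le_right (a := x)
    · rintro h x ⟨hx, hx'⟩
      have := (ImplicativeMeetSemilattice.le_himp_iff_inf_le _ _ _).1 (h hx)
      exact (le_inf le_rfl hx').trans this

theorem MIFormula.eval_le {n : ℕ} {A : Type u} [ImplicativeMeetSemilattice A] (a : Fin n → A)
    {φ ψ : MIFormula n} (h : Entails φ.toFormula ψ.toFormula) : φ.eval a ≤ ψ.eval a := by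
  have := Provable.sound (fun i => LowerSet.Iic (a i)) h (LowerSet.Iic (φ.eval a))
    (by rintro γ rfl; exact (MIFormula.eval_toFormula a φ).ge)
  rw [MIFormula.eval_toFormula] at this
  exact this (le_refl (φ.eval a))

/-- The universal property of `F_{∧,→}(n)`. -/
theorem FreeMI.universal {n : ℕ} {A : Type u} [ImplicativeMeetSemilattice A] (a : Fin n → A) :
    ∃! h : MeetImpHom (FreeMI n) A, ∀ i, h.toFun (FreeMI.mk (MIFormula.var i)) = a i := by
  refine ⟨⟨Quotient.lift (MIFormula.eval a)
      fun _ _ h => le_antisymm (MIFormula.eval_le a h.1) (MIFormula.eval_le a h.2), ?_, ?_⟩,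
    fun _ => rfl, ?_⟩
  · rintro ⟨φ⟩ ⟨ψ⟩; rfl
  · rintro ⟨φ⟩ ⟨ψ⟩; rfl
  · intro g hg
    have htop : g.toFun ⊤ = ⊤ := by
      have h₁ : (⊤ : FreeMI n) ⇨ ⊤ = ⊤ :=
        le_antisymm le_top ((ImplicativeMeetSemilattice.le_himp_iff_inf_le _ _ _).2 le_top)
      rw [← h₁, g.map_himp]
      exact le_antisymm le_top
        ((ImplicativeMeetSemilattice.le_himp_iff_inf_le _ _ _).2 inf_le_right)
    have : ∀ φ : MIFormula n, g.toFun (FreeMI.mk φ) = φ.eval a := by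
      intro φ
      induction φ with
      | var i => exact hg i
      | top => exact htop
      | and φ ψ ih₁ ih₂ =>
        exact (g.map_inf (FreeMI.mk φ) (FreeMI.mk ψ)).trans (congrArg₂ _ ih₁ ih₂)
      | imp φ ψ ih₁ ih₂ =>
        exact (g.map_himp (FreeMI.mk φ) (FreeMI.mk ψ)).trans (congrArg₂ _ ih₁ ih₂)
    obtain ⟨gf, _, _⟩ := g
    congr 1
    funext x
    obtain ⟨φ⟩ := x
    exact this φ

/-! ### Kripke models -/

/-- A model in `n` variables: a poset with an order-preserving colouring by `2^n`. -/
structure Model (n : ℕ) where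
  Point : Type
  [order : PartialOrder Point]
  colour : Point →o (Fin n → Prop)

attribute [instance] Model.order

/-- A p-morphism of models. -/
@[ext]
structure PMorphism {n : ℕ} (M N : Model n) where
  toFun : M.Point → N.Point
  monotone : Monotone toFun
  back : ∀ (x : M.Point) (y : N.Point), toFun x ≤ y → ∃ x', x ≤ x' ∧ toFun x' = y
  colour_eq : ∀ x : M.Point, N.colour (toFun x) = M.colour x

/-- The submodel on a set of points, with the restricted order and colouring. -/
def Model.sub {n : ℕ} (M : Model n) (S : Set M.Point) : Model n where
  Point := S
  colour := ⟨fun x => M.colour x.1, fun _ _ h => M.colour.monotone h⟩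

/-- `u` is a border point of `A`: a maximal element of the complement of `A`. -/
def IsBorderPoint {X : Type u} [PartialOrder X] (A : Set X) (u : X) : Prop :=
  u ∉ A ∧ ∀ y, u < y → y ∈ A

/-- A point is separated if, for some variable `q`, it is a border point of the set of points at
which `q` is true. -/
def Model.IsSeparated {n : ℕ} (M : Model n) (x : M.Point) : Prop :=
  ∃ q : Fin n, IsBorderPoint {y | M.colour y q} x

/-- The submodel `M^s` of separated points. -/
def Model.separatedPart {n : ℕ} (M : Model n) : Model n := M.sub {x | M.IsSeparated x}

/-- A prime filter of a bounded lattice. -/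
@[ext]
structure PrimeFilter (D : Type u) [Lattice D] [BoundedOrder D] where
  carrier : Set D
  upward : IsUpperSet carrier
  top_mem : ⊤ ∈ carrier
  inf_mem : ∀ a ∈ carrier, ∀ b ∈ carrier, a ⊓ b ∈ carrier
  bot_notMem : ⊥ ∉ carrier
  prime : ∀ a b, a ⊔ b ∈ carrier → a ∈ carrier ∨ b ∈ carrier

/-- Prime filters are ordered by inclusion. -/
instance (D : Type u) [Lattice D] [BoundedOrder D] : PartialOrder (PrimeFilter D) :=
  PartialOrder.lift PrimeFilter.carrier fun _ _ h => PrimeFilter.ext h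

/-- The canonical model `C(n)`: the dual poset of `F_HA(n)`, where `p_i` is true at `x` iff
`p_i ∈ x`. -/
def canonicalModel (n : ℕ) : Model n where
  Point := PrimeFilter (FreeHA n)
  colour := ⟨fun x i => FreeHA.mk (Formula.var i) ∈ x.carrier, fun _ _ h _ hx => Set.mem_of_subset_of_mem h hx⟩

/-- The universal model `U(n)`: the submodel of `C(n)` of the points with finitely many
successors. -/
def universalModel (n : ℕ) : Model n := (canonicalModel n).sub {x | (Set.Ici x).Finite}

/-- The model `M_{∧,→}`: the submodel of `U(n)` on the image of the p-morphism `M^s → U(n)`.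
(For every `M` this p-morphism exists and is unique.) -/
def Model.meetImp {n : ℕ} (M : Model n) : Model n :=
  (universalModel n).sub
    {w | ∃ f : PMorphism M.separatedPart (universalModel n), w ∈ Set.range f.toFun}

end IPC

namespace IPC

/-! ### Separation by prime filters -/

/-! Formulas are evaluated by Kripke semantics. Sending a point with finitely many successors to its
theory is a p-morphism into U(n) (`Model.exists_theory_eq`). P-morphisms preserve truth and a point
of U(n) is the set of formulas true there, so a p-morphism into U(n) is unique. Filtration then
shows that U(n) refutes every non-entailment.

The (∧,→)-fragment sees only separated points: if a variable fails at x, it fails at a maximal such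
point above x, which is separated, and an implication reduces to its conclusion
(`Model.forces_of_isSeparated`). Hence passing from U(n) to U(n)^s, and on to its image in U(n),
preserves the truth of fragment formulas, and truth sets on the image embed F_{∧,→}(n).

The image is finite: colours increase strictly along its order (`meetImp.colour_lt`), and a point of
U(n) is determined by its colour and its strict successors (`universalModel.eq_of_Ioi_eq`). So
F_{∧,→}(n) is finite, and freeness gives local finiteness. -/

theorem PrimeFilter.exists_of_notMem {D : Type u} [DistribLattice D] [BoundedOrder D]
    {F : Set D} (hup : IsUpperSet F) (htop : ⊤ ∈ F) (hinf : ∀ a ∈ F, ∀ b ∈ F, a ⊓ b ∈ F)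
    {b : D} (hb : b ∉ F) : ∃ y : PrimeFilter D, F ⊆ y.carrier ∧ b ∉ y.carrier := by
  have hF : Order.IsPFilter F := .of_def ⟨⊤, htop⟩
    (fun x hx y hy => ⟨x ⊓ y, hinf x hx y hy, inf_le_left, inf_le_right⟩) (fun h hx => hup h hx)
  have hdisj : Disjoint (hF.toPFilter : Set D) (Order.Ideal.principal b : Set D) := by
    rw [Set.disjoint_left]
    intro x hx hxb
    exact hb (hup (Order.Ideal.mem_principal.1 hxb) hx)
  obtain ⟨J, hJ, hbJ, hFJ⟩ := DistribLattice.prime_ideal_of_disjoint_filter_ideal hdisj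
  have hFJ' : ∀ x ∈ F, x ∉ J := fun x hx hxJ => Set.disjoint_left.1 hFJ hx hxJ
  -- The complement of the prime ideal `J` is the required prime filter.
  refine ⟨⟨{x | x ∉ J}, fun x y hxy hx hy => hx (J.lower hxy hy), hFJ' _ htop, ?_, ?_, ?_⟩,
    hFJ', fun h => h (hbJ (Order.Ideal.mem_principal.2 le_rfl))⟩
  · intro x hx y hy h
    exact (hJ.mem_or_mem h).elim hx hy
  · exact fun h => h J.bot_mem
  · intro x y h
    by_contra! h'
    simp only [Set.mem_ofPred_eq, not_not] at h'
    exact h (Order.Ideal.sup_mem h'.1 h'.2)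

theorem PrimeFilter.himp_mem_iff {D : Type u} [HeytingAlgebra D] (x : PrimeFilter D) (a b : D) :
    a ⇨ b ∈ x.carrier ↔ ∀ y : PrimeFilter D, x ≤ y → a ∈ y.carrier → b ∈ y.carrier := by
  constructor
  · intro h y hxy ha
    exact y.upward himp_inf_le (y.inf_mem _ (hxy h) _ ha)
  · intro h
    by_contra hab
    -- This set is the filter generated by `x` and `a`; it omits `b` because `a ⇨ b ∉ x`.
    obtain ⟨y, hxy, hby⟩ := PrimeFilter.exists_of_notMem (F := {c | a ⇨ c ∈ x.carrier})
      (fun c d hcd hc => x.upward (himp_le_himp_left hcd) hc)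
      (by simpa using x.top_mem)
      (fun c hc d hd => by
        simp only [Set.mem_ofPred_eq, himp_inf_distrib] at *
        exact x.inf_mem _ hc _ hd) hab
    refine hby (h y (fun c hc => hxy (x.upward le_himp hc)) (hxy ?_))
    simpa using x.top_mem

/-! ### Forcing -/

/-- Truth of a formula at a point of a model. -/
def Model.Forces {n : ℕ} (M : Model n) : Formula n → M.Point → Prop
  | .var i, x => M.colour x i
  | .bot, _ => False
  | .top, _ => True
  | .and φ ψ, x => M.Forces φ x ∧ M.Forces ψ x
  | .or φ ψ, x => M.Forces φ x ∨ M.Forces ψ x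
  | .imp φ ψ, x => ∀ y, x ≤ y → M.Forces φ y → M.Forces ψ y

theorem Model.Forces.mono {n : ℕ} {M : Model n} {φ : Formula n} {x y : M.Point}
    (h : M.Forces φ x) (hxy : x ≤ y) : M.Forces φ y := by
  induction φ with
  | var i => exact M.colour.monotone hxy i h
  | bot => exact h
  | top => trivial
  | and φ ψ ih₁ ih₂ => exact ⟨ih₁ h.1, ih₂ h.2⟩
  | or φ ψ ih₁ ih₂ => exact h.imp ih₁ ih₂
  | imp φ ψ _ _ => exact fun z hyz => h z (hxy.trans hyz)

theorem Provable.forces {n : ℕ} {M : Model n} {Γ : Set (Formula n)} {φ : Formula n}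
    (h : Provable Γ φ) : ∀ x : M.Point, (∀ γ ∈ Γ, M.Forces γ x) → M.Forces φ x := by
  have key : ∀ (Γ : Set (Formula n)) (φ : Formula n) (x : M.Point), (∀ γ ∈ Γ, M.Forces γ x) →
      M.Forces φ x → ∀ γ ∈ insert φ Γ, M.Forces γ x := by
    rintro Γ φ x hx hφ γ (rfl | hγ)
    exacts [hφ, hx γ hγ]
  induction h with
  | ax h => exact fun x hx => hx _ h
  | topI => exact fun _ _ => trivial
  | botE _ ih => exact fun x hx => (ih x hx).elim
  | andI _ _ ih₁ ih₂ => exact fun x hx => ⟨ih₁ x hx, ih₂ x hx⟩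
  | andE₁ _ ih => exact fun x hx => (ih x hx).1
  | andE₂ _ ih => exact fun x hx => (ih x hx).2
  | orI₁ _ ih => exact fun x hx => .inl (ih x hx)
  | orI₂ _ ih => exact fun x hx => .inr (ih x hx)
  | orE _ _ _ ih ih₁ ih₂ =>
    exact fun x hx => (ih x hx).elim (fun h => ih₁ x (key _ _ x hx h))
      fun h => ih₂ x (key _ _ x hx h)
  | impI _ ih =>
    exact fun x hx y hxy hy => ih y (key _ _ y (fun γ hγ => (hx γ hγ).mono hxy) hy)
  | impE _ _ ih₁ ih₂ => exact fun x hx => ih₁ x hx x le_rfl (ih₂ x hx)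

theorem Entails.forces {n : ℕ} {M : Model n} {φ ψ : Formula n} (h : Entails φ ψ) {x : M.Point}
    (hx : M.Forces φ x) : M.Forces ψ x :=
  Provable.forces h x (by rintro γ rfl; exact hx)

theorem PMorphism.forces_iff {n : ℕ} {M N : Model n} (f : PMorphism M N) (φ : Formula n)
    (x : M.Point) : N.Forces φ (f.toFun x) ↔ M.Forces φ x := by
  induction φ generalizing x with
  | var i => exact iff_of_eq (congrFun (f.colour_eq x) i)
  | bot => exact Iff.rfl
  | top => exact Iff.rfl
  | and φ ψ ih₁ ih₂ => exact and_congr (ih₁ x) (ih₂ x)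
  | or φ ψ ih₁ ih₂ => exact or_congr (ih₁ x) (ih₂ x)
  | imp φ ψ ih₁ ih₂ =>
    constructor
    · intro h y hxy hy
      exact (ih₂ y).1 (h _ (f.monotone hxy) ((ih₁ y).2 hy))
    · intro h y hxy hy
      obtain ⟨x', hx', rfl⟩ := f.back x y hxy
      exact (ih₂ x').2 (h x' hx' ((ih₁ x').1 hy))

/-- The prime filter of the classes of formulas true at a point. -/
def Model.theory {n : ℕ} (M : Model n) (x : M.Point) : PrimeFilter (FreeHA n) where
  carrier := {a | Quotient.lift (s := formulaSetoid n) (fun φ => M.Forces φ x)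
    (fun _ _ h => propext ⟨h.1.forces, h.2.forces⟩) a}
  upward := by rintro ⟨φ⟩ ⟨ψ⟩ h; exact Entails.forces h
  top_mem := trivial
  inf_mem := by rintro ⟨φ⟩ hφ ⟨ψ⟩ hψ; exact ⟨hφ, hψ⟩
  bot_notMem := id
  prime := by rintro ⟨φ⟩ ⟨ψ⟩ h; exact h

theorem Model.theory_mono {n : ℕ} (M : Model n) : Monotone M.theory := by
  rintro x y hxy ⟨φ⟩ hφ
  exact Model.Forces.mono (φ := φ) hφ hxy

theorem Model.himp_mem_theory {n : ℕ} {M : Model n} {x : M.Point} {a b : FreeHA n}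
    (h : ∀ y, x ≤ y → a ∈ (M.theory y).carrier → b ∈ (M.theory y).carrier) :
    a ⇨ b ∈ (M.theory x).carrier := by
  obtain ⟨φ⟩ := a
  obtain ⟨ψ⟩ := b
  exact h

/-- This is the back condition for the theory map. If `y` differs from the theories of all the
finitely many successors of `x`, each successor satisfies some sequent from a member `a` of `y` to a
non-member `b`. The meet of the `a`s and the join of the `b`s (where `y` is prime) give one
implication valid above `x`, hence in `y`, contradicting modus ponens. -/
theorem Model.exists_theory_eq {n : ℕ} {M : Model n} {x : M.Point} (hx : (Set.Ici x).Finite)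
    {y : PrimeFilter (FreeHA n)} (hxy : M.theory x ≤ y) : ∃ x', x ≤ x' ∧ M.theory x' = y := by
  by_contra! hne
  have key : ∀ s : Set M.Point, s.Finite → s ⊆ Set.Ici x → ∃ a ∈ y.carrier, ∃ b ∉ y.carrier,
      ∀ z ∈ s, a ∈ (M.theory z).carrier → b ∈ (M.theory z).carrier := by
    intro s hs
    induction s, hs using Set.Finite.induction_on with
    | empty => exact fun _ => ⟨⊤, y.top_mem, ⊥, y.bot_notMem, by simp⟩
    | @insert z s _ _ ih =>
      intro hsx
      obtain ⟨a, ha, b, hb, hab⟩ := ih ((Set.subset_insert z s).trans hsx)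
      obtain ⟨a', ha', b', hb', hab'⟩ : ∃ a' ∈ y.carrier, ∃ b' ∉ y.carrier,
          (a' ∈ (M.theory z).carrier → b' ∈ (M.theory z).carrier) := by
        -- The pairs `(⊤, b)` and `(a, ⊥)` handle the two ways in which the theory of `z` can differ
        -- from `y`.
        by_contra! hcon
        refine hne z (hsx (Set.mem_insert z s)) (PrimeFilter.ext (Set.Subset.antisymm ?_ ?_))
        · intro b hb
          by_contra hby
          exact (hcon ⊤ y.top_mem b hby).2 hb
        · exact fun a ha => (hcon a ha ⊥ y.bot_notMem).1
      refine ⟨a ⊓ a', y.inf_mem _ ha _ ha', b ⊔ b', fun h => (y.prime _ _ h).elim hb hb', ?_⟩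
      rintro w (rfl | hw) hwa
      · exact (M.theory w).upward le_sup_right (hab' ((M.theory w).upward inf_le_right hwa))
      · exact (M.theory w).upward le_sup_left (hab w hw ((M.theory w).upward inf_le_left hwa))
  obtain ⟨a, ha, b, hb, hab⟩ := key _ hx subset_rfl
  exact hb (y.upward himp_inf_le (y.inf_mem _ (hxy (Model.himp_mem_theory hab)) _ ha))

/-! ### The universal property of the universal model -/

theorem Model.finite_Ici_sub {n : ℕ} {M : Model n} {S : Set M.Point} {x : (M.sub S).Point}
    (h : (Set.Ici x.1).Finite) : (Set.Ici x).Finite :=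
  (h.preimage Subtype.val_injective.injOn).subset fun _ hy => hy

theorem universalModel.finite_Ici {n : ℕ} (x : (universalModel n).Point) : (Set.Ici x).Finite :=
  Model.finite_Ici_sub (M := canonicalModel n) x.2

theorem universalModel.himp_mem_iff {n : ℕ} (x : (universalModel n).Point) (a b : FreeHA n) :
    a ⇨ b ∈ x.1.carrier ↔
      ∀ y : (universalModel n).Point, x ≤ y → a ∈ y.1.carrier → b ∈ y.1.carrier := by
  refine (PrimeFilter.himp_mem_iff x.1 a b).trans ?_
  constructor
  · exact fun h y hxy => h y.1 hxy
  -- U(n) is an up-set of the canonical model, so every prime filter above `x` is again a point of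
  -- U(n).
  · exact fun h y hxy => h ⟨y, x.2.subset (Set.Ici_subset_Ici.2 hxy)⟩ hxy

theorem universalModel.forces_iff {n : ℕ} (φ : Formula n) (x : (universalModel n).Point) :
    (universalModel n).Forces φ x ↔ FreeHA.mk φ ∈ x.1.carrier := by
  induction φ generalizing x with
  | var i => exact Iff.rfl
  | bot => exact iff_of_false id x.1.bot_notMem
  | top => exact iff_of_true trivial x.1.top_mem
  | and φ ψ ih₁ ih₂ =>
    refine (and_congr (ih₁ x) (ih₂ x)).trans ⟨fun h => x.1.inf_mem _ h.1 _ h.2, fun h => ⟨?_, ?_⟩⟩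
    · exact x.1.upward (inf_le_left (a := FreeHA.mk φ) (b := FreeHA.mk ψ)) h
    · exact x.1.upward (inf_le_right (a := FreeHA.mk φ) (b := FreeHA.mk ψ)) h
  | or φ ψ ih₁ ih₂ =>
    refine (or_congr (ih₁ x) (ih₂ x)).trans ⟨fun h => h.elim ?_ ?_,
      x.1.prime (FreeHA.mk φ) (FreeHA.mk ψ)⟩
    · exact fun h => x.1.upward (le_sup_left (a := FreeHA.mk φ) (b := FreeHA.mk ψ)) h
    · exact fun h => x.1.upward (le_sup_right (a := FreeHA.mk φ) (b := FreeHA.mk ψ)) h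
  | imp φ ψ ih₁ ih₂ =>
    refine Iff.trans ?_ (universalModel.himp_mem_iff x (FreeHA.mk φ) (FreeHA.mk ψ)).symm
    exact forall₂_congr fun y _ => imp_congr (ih₁ y) (ih₂ y)

theorem universalModel.ext_forces {n : ℕ} {x y : (universalModel n).Point}
    (h : ∀ φ, (universalModel n).Forces φ x ↔ (universalModel n).Forces φ y) : x = y := by
  refine Subtype.ext (PrimeFilter.ext (Set.ext ?_))
  rintro ⟨φ⟩
  exact (universalModel.forces_iff φ x).symm.trans ((h φ).trans (universalModel.forces_iff φ y))

theorem PMorphism.universalModel_unique {n : ℕ} {M : Model n}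
    (f g : PMorphism M (universalModel n)) : f = g :=
  PMorphism.ext (funext fun x => universalModel.ext_forces fun φ =>
    (f.forces_iff φ x).trans (g.forces_iff φ x).symm)

/-- The p-morphism to the universal model that sends a point to its theory. -/
def Model.toUniversal {n : ℕ} (M : Model n) (hM : ∀ x : M.Point, (Set.Ici x).Finite) :
    PMorphism M (universalModel n) where
  -- Every prime filter above the theory of `x` is the theory of one of its finitely many
  -- successors.
  toFun x := ⟨M.theory x, ((hM x).image M.theory).subset fun _ hy =>
    Model.exists_theory_eq (hM x) hy⟩
  monotone _ _ h := M.theory_mono h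
  back x y h := by
    obtain ⟨x', hx', h'⟩ := Model.exists_theory_eq (hM x) h
    exact ⟨x', hx', Subtype.ext h'⟩
  colour_eq _ := rfl

/-! ### The finite model property -/

/-- The set of subformulas of a formula. -/
def Formula.subformulas {n : ℕ} : Formula n → Set (Formula n)
  | .var i => {.var i}
  | .bot => {.bot}
  | .top => {.top}
  | .and φ ψ => insert (.and φ ψ) (φ.subformulas ∪ ψ.subformulas)
  | .or φ ψ => insert (.or φ ψ) (φ.subformulas ∪ ψ.subformulas)
  | .imp φ ψ => insert (.imp φ ψ) (φ.subformulas ∪ ψ.subformulas)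

theorem Formula.finite_subformulas {n : ℕ} (φ : Formula n) : φ.subformulas.Finite := by
  induction φ with
  | var i => exact Set.finite_singleton _
  | bot => exact Set.finite_singleton _
  | top => exact Set.finite_singleton _
  | and φ ψ ih₁ ih₂ => exact (ih₁.union ih₂).insert _
  | or φ ψ ih₁ ih₂ => exact (ih₁.union ih₂).insert _
  | imp φ ψ ih₁ ih₂ => exact (ih₁.union ih₂).insert _

theorem Formula.self_mem_subformulas {n : ℕ} (φ : Formula n) : φ ∈ φ.subformulas := by
  cases φ <;> simp [Formula.subformulas]

/-- The formulas in `S` whose class lies in the prime filter `x`. -/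
def PrimeFilter.trace {n : ℕ} (S : Set (Formula n)) (x : PrimeFilter (FreeHA n)) :
    Set (Formula n) := {φ | φ ∈ S ∧ FreeHA.mk φ ∈ x.carrier}

/-- The filtration of the canonical model through a set of formulas. -/
def filtration {n : ℕ} (S : Set (Formula n)) : Model n where
  Point := Set.range (PrimeFilter.trace S)
  colour := ⟨fun T i => Formula.var i ∈ T.1, fun _ _ h _ hx => Set.mem_of_subset_of_mem h hx⟩

theorem filtration.finite {n : ℕ} {S : Set (Formula n)} (hS : S.Finite) :
    Finite (filtration S).Point := by
  refine (hS.finite_subsets.subset ?_).to_subtype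
  rintro _ ⟨x, rfl⟩ φ hφ
  exact hφ.1

theorem filtration.forces_iff {n : ℕ} {S : Set (Formula n)} (φ : Formula n)
    (hφ : φ.subformulas ⊆ S) (T : (filtration S).Point) :
    (filtration S).Forces φ T ↔ φ ∈ T.1 := by
  induction φ generalizing T with
  | var i => exact Iff.rfl
  | bot =>
    obtain ⟨_, x, rfl⟩ := T
    exact iff_of_false id fun h => x.bot_notMem h.2
  | top =>
    obtain ⟨_, x, rfl⟩ := T
    exact iff_of_true trivial ⟨hφ (Formula.self_mem_subformulas _), x.top_mem⟩
  | and φ ψ ih₁ ih₂ =>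
    have hS := Set.insert_subset_iff.1 hφ
    have hS' := Set.union_subset_iff.1 hS.2
    refine (and_congr (ih₁ hS'.1 T) (ih₂ hS'.2 T)).trans ?_
    obtain ⟨_, x, rfl⟩ := T
    constructor
    · exact fun h => ⟨hS.1, x.inf_mem _ h.1.2 _ h.2.2⟩
    · intro h
      exact ⟨⟨hS'.1 φ.self_mem_subformulas,
          x.upward (inf_le_left (a := FreeHA.mk φ) (b := FreeHA.mk ψ)) h.2⟩,
        ⟨hS'.2 ψ.self_mem_subformulas,
          x.upward (inf_le_right (a := FreeHA.mk φ) (b := FreeHA.mk ψ)) h.2⟩⟩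
  | or φ ψ ih₁ ih₂ =>
    have hS := Set.insert_subset_iff.1 hφ
    have hS' := Set.union_subset_iff.1 hS.2
    refine (or_congr (ih₁ hS'.1 T) (ih₂ hS'.2 T)).trans ?_
    obtain ⟨_, x, rfl⟩ := T
    constructor
    · rintro (h | h)
      · exact ⟨hS.1, x.upward (le_sup_left (a := FreeHA.mk φ) (b := FreeHA.mk ψ)) h.2⟩
      · exact ⟨hS.1, x.upward (le_sup_right (a := FreeHA.mk φ) (b := FreeHA.mk ψ)) h.2⟩
    · intro h
      exact (x.prime (FreeHA.mk φ) (FreeHA.mk ψ) h.2).imp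
        (fun h => ⟨hS'.1 φ.self_mem_subformulas, h⟩) fun h => ⟨hS'.2 ψ.self_mem_subformulas, h⟩
  | imp φ ψ ih₁ ih₂ =>
    have hS := Set.insert_subset_iff.1 hφ
    have hS' := Set.union_subset_iff.1 hS.2
    refine (forall₂_congr fun y _ => imp_congr (ih₁ hS'.1 y) (ih₂ hS'.2 y)).trans ?_
    obtain ⟨_, x, rfl⟩ := T
    constructor
    · refine fun h => ⟨hS.1, (x.himp_mem_iff (FreeHA.mk φ) (FreeHA.mk ψ)).2 fun y hxy hy => ?_⟩
      exact (h ⟨_, y, rfl⟩ (fun χ hχ => ⟨hχ.1, hxy hχ.2⟩)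
        ⟨hS'.1 φ.self_mem_subformulas, hy⟩).2
    -- The implication itself lies in `S`, so inclusion of traces carries it from `x` to `y`,
    -- although `x ≤ y` need not hold.
    · rintro h ⟨_, y, rfl⟩ hxy hy
      have hy' := (hxy h).2
      exact ⟨hS'.2 ψ.self_mem_subformulas,
        y.upward (himp_inf_le (a := FreeHA.mk φ) (b := FreeHA.mk ψ)) (y.inf_mem _ hy' _ hy.2)⟩

/-- A prime filter containing `φ` but not `ψ` may have infinitely many successors. Its trace in the
finite filtration agrees with it on subformulas, and the theory map carries this trace into U(n). -/
theorem universalModel.exists_of_not_entails {n : ℕ} {φ ψ : Formula n} (h : ¬ Entails φ ψ) :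
    ∃ x, (universalModel n).Forces φ x ∧ ¬ (universalModel n).Forces ψ x := by
  obtain ⟨y, hφ, hψ⟩ := PrimeFilter.exists_of_notMem (F := Set.Ici (FreeHA.mk φ))
    (b := FreeHA.mk ψ) (isUpperSet_Ici _) (Set.mem_Ici.2 le_top)
    (fun _ ha _ hb => Set.mem_Ici.2 (le_inf ha hb)) h
  set S := φ.subformulas ∪ ψ.subformulas
  have := filtration.finite (S := S) (φ.finite_subformulas.union ψ.finite_subformulas)
  let f := (filtration S).toUniversal fun _ => Set.toFinite _
  let T : (filtration S).Point := ⟨_, y, rfl⟩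
  refine ⟨f.toFun T, (f.forces_iff φ T).2 ((filtration.forces_iff φ Set.subset_union_left T).2
    ⟨.inl φ.self_mem_subformulas, hφ Set.self_mem_Ici⟩), fun hT => hψ ?_⟩
  exact ((filtration.forces_iff ψ Set.subset_union_right T).1 ((f.forces_iff ψ T).1 hT)).2

/-! ### Separated points -/

/-- Truth of a formula of the fragment is determined by the separated points above. -/
theorem Model.forces_of_isSeparated {n : ℕ} {M : Model n}
    (hM : ∀ x : M.Point, (Set.Ici x).Finite) (φ : MIFormula n) {x : M.Point}
    (h : ∀ y, x ≤ y → M.IsSeparated y → M.Forces φ.toFormula y) : M.Forces φ.toFormula x := by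
  induction φ generalizing x with
  | var i =>
    by_contra hx
    -- A maximal point above `x` at which the variable fails is separated by that variable.
    obtain ⟨y, ⟨hxy, hy⟩, hmax⟩ :=
      ((hM x).subset (fun _ hy => hy.1 : {y | x ≤ y ∧ ¬ M.colour y i} ⊆ Set.Ici x)).exists_maximal
        ⟨x, le_rfl, hx⟩
    refine hy (h y hxy ⟨i, hy, fun z hyz => ?_⟩)
    by_contra hz
    exact hyz.not_ge (hmax ⟨hxy.trans hyz.le, hz⟩ hyz.le)
  | top => trivial
  | and φ ψ ih₁ ih₂ =>
    exact ⟨ih₁ fun y hxy hy => (h y hxy hy).1, ih₂ fun y hxy hy => (h y hxy hy).2⟩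
  | imp φ ψ _ ih₂ =>
    -- Truth of `φ` at `y` persists upwards, so the hypothesis yields `ψ` at all separated points
    -- above `y`; induction is needed for the conclusion only.
    intro y hxy hy
    exact ih₂ fun z hyz hz => h z (hxy.trans hyz) hz z le_rfl (hy.mono hyz)

/-- The inclusion of M^s need not be a p-morphism. It still preserves fragment formulas, since a
conclusion that holds at all separated points above a point holds at that point. -/
theorem Model.separatedPart_forces_iff {n : ℕ} {M : Model n}
    (hM : ∀ x : M.Point, (Set.Ici x).Finite) (φ : MIFormula n) (x : M.separatedPart.Point) :
    M.separatedPart.Forces φ.toFormula x ↔ M.Forces φ.toFormula x.1 := by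
  induction φ generalizing x with
  | var i => exact Iff.rfl
  | top => exact Iff.rfl
  | and φ ψ ih₁ ih₂ => exact and_congr (ih₁ x) (ih₂ x)
  | imp φ ψ ih₁ ih₂ =>
    constructor
    · intro h y hxy hy
      refine Model.forces_of_isSeparated hM ψ fun z hyz hz => ?_
      exact (ih₂ ⟨z, hz⟩).1 (h ⟨z, hz⟩ (hxy.trans hyz) ((ih₁ ⟨z, hz⟩).2 (hy.mono hyz)))
    · intro h y hxy hy
      exact (ih₂ y).2 (h y.1 hxy ((ih₁ y).1 hy))

/-! ### The model `U(n)_{∧,→}` -/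

/-- The p-morphism `U(n)^s → U(n)`. -/
def separatedMorphism (n : ℕ) :
    PMorphism (universalModel n).separatedPart (universalModel n) :=
  Model.toUniversal _ fun x => Model.finite_Ici_sub (universalModel.finite_Ici x.1)

theorem meetImp.exists_eq {n : ℕ} (w : (universalModel n).meetImp.Point) :
    ∃ s, (separatedMorphism n).toFun s = w.1 := by
  obtain ⟨f, s, hs⟩ := w.2
  exact ⟨s, by rw [PMorphism.universalModel_unique (separatedMorphism n) f, hs]⟩

/-- The back condition makes the image of a p-morphism an up-set. -/
theorem meetImp.mem_of_le {n : ℕ} (w : (universalModel n).meetImp.Point)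
    {y : (universalModel n).Point} (h : w.1 ≤ y) :
    ∃ w' : (universalModel n).meetImp.Point, w'.1 = y := by
  obtain ⟨s, hs⟩ := meetImp.exists_eq w
  obtain ⟨s', _, hs'⟩ := (separatedMorphism n).back s y (hs ▸ h)
  exact ⟨⟨y, separatedMorphism n, s', hs'⟩, rfl⟩

/-- Lift `w < w'` to `s < s'` among separated points. The variable separating `s` is false at `s`
and true at `s'`, and p-morphisms keep colours. -/
theorem meetImp.colour_lt {n : ℕ} {w w' : (universalModel n).meetImp.Point} (h : w < w') :
    (universalModel n).meetImp.colour w < (universalModel n).meetImp.colour w' := by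
  refine lt_of_le_not_ge ((universalModel n).meetImp.colour.monotone h.le) fun hle => ?_
  obtain ⟨s, hs⟩ := meetImp.exists_eq w
  obtain ⟨s', hss', hs'⟩ := (separatedMorphism n).back s w'.1 (hs ▸ h.le)
  have hne : s ≠ s' := by
    rintro rfl
    exact h.ne (Subtype.ext (hs.symm.trans hs'))
  obtain ⟨q, hq, hq'⟩ := s.2
  have hc := congrFun ((separatedMorphism n).colour_eq s) q
  have hc' := congrFun ((separatedMorphism n).colour_eq s') q
  rw [hs] at hc
  rw [hs'] at hc'
  exact hq (hc.mp (hle q (hc'.mpr (hq' s'.1 (lt_of_le_of_ne hss' fun e => hne (Subtype.ext e))))))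

/-- By induction on formulas both points have the same theory: an implication holds at a point iff
it holds there locally and at all strict successors. -/
theorem universalModel.eq_of_Ioi_eq {n : ℕ} {x y : (universalModel n).Point}
    (hc : (universalModel n).colour x = (universalModel n).colour y)
    (h : Set.Ioi x = Set.Ioi y) : x = y := by
  refine universalModel.ext_forces fun φ => ?_
  induction φ with
  | var i => exact iff_of_eq (congrFun hc i)
  | bot => exact Iff.rfl
  | top => exact Iff.rfl
  | and φ ψ ih₁ ih₂ => exact and_congr ih₁ ih₂
  | or φ ψ ih₁ ih₂ => exact or_congr ih₁ ih₂
  | imp φ ψ ih₁ ih₂ =>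
    have key : ∀ z : (universalModel n).Point, (universalModel n).Forces (.imp φ ψ) z ↔
        ((universalModel n).Forces φ z → (universalModel n).Forces ψ z) ∧
        ∀ t ∈ Set.Ioi z, (universalModel n).Forces φ t → (universalModel n).Forces ψ t := by
      refine fun z => ⟨fun H => ⟨H z le_rfl, fun t ht => H t (le_of_lt ht)⟩, fun H t hzt => ?_⟩
      rcases hzt.eq_or_lt with rfl | hlt
      exacts [H.1, H.2 t hlt]
    rw [key, key, ih₁, ih₂, h]

theorem meetImp.eq_of_Ioi_eq {n : ℕ} {w w' : (universalModel n).meetImp.Point}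
    (hc : (universalModel n).meetImp.colour w = (universalModel n).meetImp.colour w')
    (h : Set.Ioi w = Set.Ioi w') : w = w' := by
  have key : ∀ {w w' : (universalModel n).meetImp.Point}, Set.Ioi w = Set.Ioi w' →
      Set.Ioi w.1 ⊆ Set.Ioi w'.1 := by
    intro w w' h y hy
    obtain ⟨v, rfl⟩ := meetImp.mem_of_le w (le_of_lt hy)
    have hv : v ∈ Set.Ioi w := hy
    rw [h] at hv
    exact hv
  exact Subtype.ext (universalModel.eq_of_Ioi_eq hc ((key h).antisymm (key h.symm)))

instance meetImp.finite (n : ℕ) : Finite (universalModel n).meetImp.Point := by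
  have key : ∀ c : Fin n → Prop, {w | (universalModel n).meetImp.colour w = c}.Finite := by
    intro c
    -- Descending induction on the colour: the strict successors of a point of colour `c` have
    -- larger colours, so they form a subset of a finite set, and this subset determines the point.
    induction c using WellFoundedGT.induction with
    | ind c ih =>
      have hfin : {w | c < (universalModel n).meetImp.colour w}.Finite := by
        refine ((Set.toFinite (Set.Ioi c)).biUnion ih).subset fun w hw => ?_
        exact Set.mem_biUnion (x := (universalModel n).meetImp.colour w) hw rfl
      refine Set.Finite.of_finite_image (f := Set.Ioi) (hfin.finite_subsets.subset ?_) ?_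
      · rintro _ ⟨w, rfl, rfl⟩ v hv
        exact meetImp.colour_lt hv
      · intro w hw w' hw' h
        exact meetImp.eq_of_Ioi_eq (Eq.trans hw (Eq.symm hw')) h
  refine Set.finite_univ_iff.1 (((Set.toFinite Set.univ).biUnion fun c _ => key c).subset ?_)
  exact fun w _ => Set.mem_biUnion (Set.mem_univ ((universalModel n).meetImp.colour w)) rfl

/-! ### The embedding of the free algebra -/

/-- The up-set of the points of `U(n)_{∧,→}` at which an element of `F_{∧,→}(n)` is true. -/
def FreeMI.truthSet {n : ℕ} (a : FreeMI n) : UpSets (universalModel n).meetImp.Point :=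
  ⟨{w | Quotient.map (sa := (formulaSetoid n).comap MIFormula.toFormula) (sb := formulaSetoid n)
      MIFormula.toFormula (fun _ _ h => h) a ∈ w.1.1.carrier}, fun _ _ h hw => h hw⟩

theorem FreeMI.mem_truthSet_iff {n : ℕ} (φ : MIFormula n)
    (w : (universalModel n).meetImp.Point) :
    w ∈ (FreeMI.mk φ).truthSet.1 ↔ (universalModel n).Forces φ.toFormula w.1 :=
  (universalModel.forces_iff φ.toFormula w.1).symm

/-- The `(∧,→)`-homomorphism from `F_{∧,→}(n)` to the up-sets of `U(n)_{∧,→}`. -/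
def FreeMI.truthHom (n : ℕ) :
    MeetImpHom (FreeMI n) (UpSets (universalModel n).meetImp.Point) where
  toFun := FreeMI.truthSet
  map_inf := by
    rintro ⟨φ⟩ ⟨ψ⟩
    refine Subtype.ext (Set.ext fun w => (FreeMI.mem_truthSet_iff (φ.and ψ) w).trans ?_)
    exact (and_congr (FreeMI.mem_truthSet_iff φ w) (FreeMI.mem_truthSet_iff ψ w)).symm
  map_himp := by
    rintro ⟨φ⟩ ⟨ψ⟩
    refine Subtype.ext (Set.ext fun w => (FreeMI.mem_truthSet_iff (φ.imp ψ) w).trans ⟨?_, ?_⟩)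
    · intro h v hwv hv
      exact (FreeMI.mem_truthSet_iff ψ v).2 (h v.1 hwv ((FreeMI.mem_truthSet_iff φ v).1 hv))
    · intro h y hwy hy
      -- Implication in the up-sets of the image agrees with forcing in U(n) because the image is
      -- itself an up-set.
      obtain ⟨v, rfl⟩ := meetImp.mem_of_le w hwy
      exact (FreeMI.mem_truthSet_iff ψ v).1 (h v hwy ((FreeMI.mem_truthSet_iff φ v).2 hy))

/-- A counterexample in U(n) moves up to a separated point where `ψ` fails and `φ` persists, then
along the p-morphism into U(n)_{∧,→}. -/
theorem MIFormula.entails_of_meetImp {n : ℕ} {φ ψ : MIFormula n}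
    (h : ∀ w : (universalModel n).meetImp.Point, (universalModel n).Forces φ.toFormula w.1 →
      (universalModel n).Forces ψ.toFormula w.1) : Entails φ.toFormula ψ.toFormula := by
  by_contra hne
  obtain ⟨x, hφ, hψ⟩ := universalModel.exists_of_not_entails hne
  refine hψ (Model.forces_of_isSeparated universalModel.finite_Ici ψ fun y hxy hy => ?_)
  let s : (universalModel n).separatedPart.Point := ⟨y, hy⟩
  have key : ∀ χ : MIFormula n,
      (universalModel n).Forces χ.toFormula ((separatedMorphism n).toFun s) ↔
        (universalModel n).Forces χ.toFormula y := fun χ =>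
    ((separatedMorphism n).forces_iff _ s).trans
      (Model.separatedPart_forces_iff universalModel.finite_Ici χ s)
  exact (key ψ).1 (h ⟨_, separatedMorphism n, s, rfl⟩ ((key φ).2 (hφ.mono hxy)))

theorem FreeMI.truthSet_injective (n : ℕ) : Function.Injective (FreeMI.truthSet (n := n)) := by
  have key : ∀ {φ ψ : MIFormula n}, (FreeMI.mk φ).truthSet = (FreeMI.mk ψ).truthSet →
      Entails φ.toFormula ψ.toFormula := by
    intro φ ψ h
    refine MIFormula.entails_of_meetImp fun w hw => ?_
    rwa [← FreeMI.mem_truthSet_iff, ← h, FreeMI.mem_truthSet_iff]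
  rintro ⟨φ⟩ ⟨ψ⟩ h
  exact Quotient.sound ⟨key h, key h.symm⟩

instance FreeMI.finite (n : ℕ) : Finite (FreeMI n) :=
  have : Finite (UpSets (universalModel n).meetImp.Point) :=
    inferInstanceAs (Finite {U : Set (universalModel n).meetImp.Point // IsUpperSet U})
  Finite.of_injective _ (FreeMI.truthSet_injective n)

/-! ### Local finiteness -/

theorem MeetImpHom.map_top {A : Type u} {B : Type v} [ImplicativeMeetSemilattice A]
    [ImplicativeMeetSemilattice B] (h : MeetImpHom A B) : h.toFun ⊤ = ⊤ := by
  have h₁ : (⊤ : A) ⇨ ⊤ = ⊤ :=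
    le_antisymm le_top ((ImplicativeMeetSemilattice.le_himp_iff_inf_le _ _ _).2 le_top)
  rw [← h₁, h.map_himp]
  exact le_antisymm le_top ((ImplicativeMeetSemilattice.le_himp_iff_inf_le _ _ _).2 inf_le_right)

theorem MeetImpHom.isSubalgebra_range {A : Type u} {B : Type v} [ImplicativeMeetSemilattice A]
    [ImplicativeMeetSemilattice B] (h : MeetImpHom A B) : IsSubalgebra (Set.range h.toFun) where
  top_mem := ⟨⊤, h.map_top⟩
  inf_mem := by rintro _ ⟨a, rfl⟩ _ ⟨b, rfl⟩; exact ⟨a ⊓ b, h.map_inf a b⟩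
  himp_mem := by rintro _ ⟨a, rfl⟩ _ ⟨b, rfl⟩; exact ⟨a ⇨ b, h.map_himp a b⟩

/-- The generated subalgebra lies in the range of a homomorphism from the finite free algebra on an
enumeration of `S`. -/
theorem generated_finite {A : Type u} [ImplicativeMeetSemilattice A] {S : Set A}
    (hS : S.Finite) : (generated S).Finite := by
  obtain ⟨n, a, _, rfl⟩ := Set.Finite.fin_param hS
  obtain ⟨h, hh, _⟩ := FreeMI.universal a
  refine (Set.finite_range h.toFun).subset (Set.sInter_subset_of_mem ⟨h.isSubalgebra_range, ?_⟩)
  rintro _ ⟨i, rfl⟩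
  exact ⟨_, hh i⟩

end IPC

theorem theorem3p8 :
    (∀ n : ℕ,
      (∃ f : IPC.PMorphism (IPC.universalModel n).separatedPart (IPC.universalModel n),
        ∀ g, g = f) ∧
      (∃ h : IPC.MeetImpHom (IPC.FreeMI n) (IPC.UpSets (IPC.universalModel n).meetImp.Point),
        Function.Injective h.toFun) ∧
      Finite (IPC.FreeMI n)) ∧
    (∀ (A : Type u) [IPC.ImplicativeMeetSemilattice A] (S : Set A),
      S.Finite → (IPC.generated S).Finite) :=
  ⟨fun n => ⟨⟨IPC.separatedMorphism n, fun g => g.universalModel_unique _⟩,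
    ⟨IPC.FreeMI.truthHom n, IPC.FreeMI.truthSet_injective n⟩, IPC.FreeMI.finite n⟩,
    fun _ _ _ hS => IPC.generated_finite hS⟩
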